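/- **Setting.** Let $V=V_0[[h]]$ be a topologically free $\mathbb{C}[[h]]$-module, where $V_0$ is a complex vector space. All tensor products are $h$-adically completed: $V\otimes V=(V_0\otimes V_0)[[h]]$, $V\otimes V\otimes\mathbb{C}((z))=(V_0\otimes V_0\otimes\mathbb{C}((z)))[[h]]$, etc. Let $V_h((z))$ be the space of series $\sum_{r\in\mathbb{Z}}v_rz^{-r-1}\in V[[z^{\pm1}]]$ with $v_r\to0$ $h$-adically as $r\to\infty$. Powers $(z_0+z_2)^m$, $(z_1\pm z_2)^m$ with $m\in\mathbb{Z}$ are always expanded in nonnegative powers of $z_2$. A *quantum vertex algebra* structure on $V$ consists of the following data. (a) A $\mathbb{C}[[h]]$-module map $Y:V\otimes V\to V_h((z))$, $v\otimes w\mapsto Y(z)(v\otimes w)=Y(v,z)w=\sum_{r\in\mathbb{Z}}(v_rw)z^{-r-1}$, such that for all $u,v,w\in V$ and $n\ge0$ there is $\ell\ge0$ with $$(z_0+z_2)^\ell\,Y(v,z_0+z_2)Y(w,z_2)u-(z_0+z_2)^\ell\,Y\big(Y(v,z_0)w,z_2\big)u\in h^nV[[z_0^{\pm1},z_2^{\pm1}]].$$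 (b) A vector $\mathbf 1\in V$ such that $Y(\mathbf 1,z)v=v$ for all $v\in V$, and $Y(v,z)\mathbf 1$ is a Taylor series in $z$ with constant term $v$. (c) A $\mathbb{C}[[h]]$-module map $D:V\to V$ with $D\mathbf 1=0$ and $\frac{d}{dz}Y(v,z)=[D,Y(v,z)]$ for all $v\in V$. (d) A $\mathbb{C}[[h]]$-module map $\mathcal S=\mathcal S(z):V\otimes V\to V\otimes V\otimes\mathbb{C}((z))$ such that $\mathcal S(z)(v\otimes w)-v\otimes w\otimes1\in h\,V\otimes V\otimes\mathbb{C}((z))$ for all $v,w\in V$; $[D\otimes1,\mathcal S(z)]=-\frac{d}{dz}\mathcal S(z)$; the Yang–Baxter equation $\mathcal S_{12}(z_1)\mathcal S_{13}(z_1+z_2)\mathcal S_{23}(z_2)=\mathcal S_{23}(z_2)\mathcal S_{13}(z_1+z_2)\mathcal S_{12}(z_1)$ and the unitarity condition $\mathcal S_{21}(z)=\mathcal S^{-1}(-z)$ hold; and for all $v,w\in V$, $n\ge0$ there is $\ell\ge0$ such that for all $u\in V$ $$(z_1-z_2)^\ell\,Y(z_1)\big(1\otimes Y(z_2)\big)\big(\mathcal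 S(z_1-z_2)(v\otimes w)\otimes u\big)-(z_1-z_2)^\ell\,Y(z_2)\big(1\otimes Y(z_1)\big)(w\otimes v\otimes u)\in h^nV[[z_1^{\pm1},z_2^{\pm1}]].$$ The *center* of $V$ is the $\mathbb{C}[[h]]$-submodule $\mathfrak z(V)=\{v\in V\mid w_rv=0\text{ for all }w\in V\text{ and all }r\ge0\}$. **Proposition.** Let $V$ be a quantum vertex algebra and let $v\in V$. Then $v\in\mathfrak z(V)$ if and only if $$Y(z_1)\big(1\otimes Y(z_2)\big)\big(\mathcal S(z_1-z_2)(v\otimes w)\otimes u\big)=Y(w,z_2)\,Y(v,z_1)\,u$$ (as series in $V[[z_1^{\pm1},z_2^{\pm1}]]$) for all $w\in V$ and all $u\in\mathfrak z(V)$. -/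

import Mathlib

open scoped TensorProduct PowerSeries LaurentSeries

noncomputable section

/-! ## Topologically free modules over `ℂ⟦h⟧` -/

/-- The topologically free `ℂ⟦h⟧`-module `M[[h]]` of formal power series `∑ xₙ hⁿ` in `h` with
coefficients `xₙ` in a complex vector space `M`. The variable `X` of `ℂ⟦X⟧` plays the role of
`h`. -/
@[ext] structure HSeries (M : Type*) where
  /-- The coefficient of `hⁿ`. -/
  coeff : ℕ → M

namespace HSeries

instance {M : Type*} [AddCommGroup M] : Zero (HSeries M) := ⟨⟨fun _ => 0⟩⟩
instance {M : Type*} [AddCommGroup M] : Add (HSeries M) := ⟨fun x y => ⟨fun n => x.coeff n + y.coeff n⟩⟩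
instance {M : Type*} [AddCommGroup M] : Neg (HSeries M) := ⟨fun x => ⟨fun n => -x.coeff n⟩⟩
instance {M : Type*} [AddCommGroup M] : Sub (HSeries M) := ⟨fun x y => ⟨fun n => x.coeff n - y.coeff n⟩⟩

@[simp] theorem coeff_zero {M : Type*} [AddCommGroup M] (n : ℕ) : (0 : HSeries M).coeff n = 0 := rfl
@[simp] theorem coeff_add {M : Type*} [AddCommGroup M] (x y : HSeries M) (n : ℕ) :
    (x + y).coeff n = x.coeff n + y.coeff n := rfl
@[simp] theorem coeff_neg {M : Type*} [AddCommGroup M] (x : HSeries M) (n : ℕ) :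
    (-x).coeff n = -x.coeff n := rfl
@[simp] theorem coeff_sub {M : Type*} [AddCommGroup M] (x y : HSeries M) (n : ℕ) :
    (x - y).coeff n = x.coeff n - y.coeff n := rfl

instance {M : Type*} [AddCommGroup M] : AddCommGroup (HSeries M) where
  add_assoc x y z := by ext n; simp [add_assoc]
  zero_add x := by ext n; simp
  add_zero x := by ext n; simp
  add_comm x y := by ext n; simp [add_comm]
  neg_add_cancel x := by ext n; simp
  sub_eq_add_neg x y := by ext n; simp [sub_eq_add_neg]
  nsmul := nsmulRec
  zsmul := zsmulRec

section Module

variable {M N : Type*} [AddCommGroup M] [Module ℂ M] [AddCommGroup N] [Module ℂ N]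

/-- Multiplication of a power series in `M[[h]]` by a scalar power series (Cauchy product). -/
instance : SMul ℂ⟦X⟧ (HSeries M) :=
  ⟨fun f x => ⟨fun n =>
    ∑ p ∈ Finset.HasAntidiagonal.antidiagonal n, PowerSeries.coeff p.1 f • x.coeff p.2⟩⟩

theorem coeff_smul (f : ℂ⟦X⟧) (x : HSeries M) (n : ℕ) :
    (f • x).coeff n =
      ∑ p ∈ Finset.HasAntidiagonal.antidiagonal n, PowerSeries.coeff p.1 f • x.coeff p.2 := rfl

theorem coeff_C_smul (c : ℂ) (x : HSeries M) (n : ℕ) :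
    ((PowerSeries.C c : ℂ⟦X⟧) • x).coeff n = c • x.coeff n := by
  rw [coeff_smul, Finset.sum_eq_single (0, n)]
  · simp
  · rintro ⟨i, j⟩ hp hne
    have hi : i ≠ 0 := by
      rintro rfl
      apply hne
      simpa using hp
    simp [PowerSeries.coeff_C, hi]
  · simp

instance : Module ℂ⟦X⟧ (HSeries M) where
  one_smul x := by
    ext n
    rw [← map_one (PowerSeries.C (R := ℂ)), coeff_C_smul, one_smul]
  mul_smul f g x := by
    ext n
    simp only [coeff_smul, PowerSeries.coeff_mul, Finset.sum_smul, Finset.smul_sum, mul_smul]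
    rw [Finset.sum_sigma', Finset.sum_sigma']
    exact Finset.sum_nbij'
      (fun p => ⟨(p.2.1, p.2.2 + p.1.2), (p.2.2, p.1.2)⟩)
      (fun p => ⟨(p.1.1 + p.2.1, p.2.2), (p.1.1, p.2.1)⟩)
      (by rintro ⟨⟨a, b⟩, ⟨c, d⟩⟩ h; simp at h ⊢; omega)
      (by rintro ⟨⟨a, b⟩, ⟨c, d⟩⟩ h; simp at h ⊢; omega)
      (by rintro ⟨⟨a, b⟩, ⟨c, d⟩⟩ h; simp at h ⊢; obtain ⟨_, rfl⟩ := h; rfl)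
      (by rintro ⟨⟨a, b⟩, ⟨c, d⟩⟩ h; simp at h ⊢; obtain ⟨_, rfl⟩ := h; rfl)
      (by rintro ⟨⟨a, b⟩, ⟨c, d⟩⟩ h; rfl)
  smul_zero f := by ext n; simp [coeff_smul]
  smul_add f x y := by ext n; simp [coeff_smul, Finset.sum_add_distrib]
  add_smul f g x := by ext n; simp [coeff_smul, add_smul, Finset.sum_add_distrib]
  zero_smul x := by ext n; simp [coeff_smul]

/-- The submodule `h^n M[[h]]`. -/
def hPow (M : Type*) [AddCommGroup M] [Module ℂ M] (n : ℕ) : Submodule ℂ⟦X⟧ (HSeries M) where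
  carrier := {x | ∃ y : HSeries M, x = (PowerSeries.X ^ n : ℂ⟦X⟧) • y}
  add_mem' := by
    rintro _ _ ⟨y, rfl⟩ ⟨z, rfl⟩
    exact ⟨y + z, (smul_add _ _ _).symm⟩
  zero_mem' := ⟨0, (smul_zero _).symm⟩
  smul_mem' := by
    rintro c _ ⟨y, rfl⟩
    exact ⟨c • y, smul_comm _ _ _⟩

/-- The constant series of an element of `M`. -/
def const (m : M) : HSeries M := ⟨fun n => if n = 0 then m else 0⟩

/-- The sum of an `h`-adically convergent family (a family `x` such that, for every `k`, all but
finitely many members lie in `h^(k+1) M[[h]]`), computed coefficient by coefficient. -/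
def hsum {ι : Type*} (x : ι → HSeries M) : HSeries M := ⟨fun k => ∑ᶠ i, (x i).coeff k⟩

/-- The element `x ⊗ y` of the `h`-adically completed tensor product
`M[[h]] ⊗ N[[h]] = (M ⊗ N)[[h]]`. -/
def tmul (x : HSeries M) (y : HSeries N) : HSeries (M ⊗[ℂ] N) :=
  ⟨fun n => ∑ p ∈ Finset.HasAntidiagonal.antidiagonal n, x.coeff p.1 ⊗ₜ[ℂ] y.coeff p.2⟩

theorem tmul_add (x : HSeries M) (y y' : HSeries N) : tmul x (y + y') = tmul x y + tmul x y' := by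
  ext n
  simp [tmul, TensorProduct.tmul_add, Finset.sum_add_distrib]

theorem tmul_smul (f : ℂ⟦X⟧) (x : HSeries M) (y : HSeries N) :
    tmul x (f • y) = f • tmul x y := by
  ext n
  simp only [tmul, coeff_smul, TensorProduct.tmul_sum, TensorProduct.tmul_smul, Finset.smul_sum]
  rw [Finset.sum_sigma', Finset.sum_sigma']
  exact Finset.sum_nbij'
    (fun p => ⟨(p.2.1, p.1.1 + p.2.2), (p.1.1, p.2.2)⟩)
    (fun p => ⟨(p.2.1, p.1.1 + p.2.2), (p.1.1, p.2.2)⟩)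
    (by rintro ⟨⟨a, b⟩, ⟨c, d⟩⟩ h; simp at h ⊢; omega)
    (by rintro ⟨⟨a, b⟩, ⟨c, d⟩⟩ h; simp at h ⊢; omega)
    (by rintro ⟨⟨a, b⟩, ⟨c, d⟩⟩ h; simp at h ⊢; obtain ⟨_, rfl⟩ := h; rfl)
    (by rintro ⟨⟨a, b⟩, ⟨c, d⟩⟩ h; simp at h ⊢; obtain ⟨_, rfl⟩ := h; rfl)
    (by rintro ⟨⟨a, b⟩, ⟨c, d⟩⟩ h; rfl)

/-- A `ℂ⟦h⟧`-linear map `G : M[[h]] → N[[h]]` is a formal power series `G = ∑ Gₙ hⁿ` with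
coefficients in `Hom(M, N)`; this is the coefficient `Gₙ`. -/
def homCoeff (G : HSeries M →ₗ[ℂ⟦X⟧] HSeries N) (n : ℕ) : M →ₗ[ℂ] N where
  toFun m := (G (const m)).coeff n
  map_add' m m' := by
    have : const (m + m') = const m + const m' := by
      ext k; by_cases hk : k = 0 <;> simp [const, hk]
    rw [this, map_add, coeff_add]
  map_smul' c m := by
    have : const (c • m) = (PowerSeries.C c : ℂ⟦X⟧) • const m := by
      ext k; rw [coeff_C_smul]; by_cases hk : k = 0 <;> simp [const, hk]
    rw [this, map_smul, coeff_C_smul, RingHom.id_apply]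

/-- The `ℂ⟦h⟧`-linear map `M[[h]] → N[[h]]` given by a formal power series `∑ gₙ hⁿ` with
coefficients in `Hom(M, N)`. It is inverse to taking the coefficients `homCoeff`. -/
def ofHomCoeff (g : ℕ → (M →ₗ[ℂ] N)) : HSeries M →ₗ[ℂ⟦X⟧] HSeries N where
  toFun x := ⟨fun n => ∑ p ∈ Finset.HasAntidiagonal.antidiagonal n, g p.1 (x.coeff p.2)⟩
  map_add' x y := by
    ext n
    simp [Finset.sum_add_distrib]
  map_smul' f x := by
    ext n
    simp only [coeff_smul, map_sum, map_smul, RingHom.id_apply, Finset.smul_sum]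
    rw [Finset.sum_sigma', Finset.sum_sigma']
    exact Finset.sum_nbij'
      (fun p => ⟨(p.2.1, p.1.1 + p.2.2), (p.1.1, p.2.2)⟩)
      (fun p => ⟨(p.2.1, p.1.1 + p.2.2), (p.1.1, p.2.2)⟩)
      (by rintro ⟨⟨a, b⟩, ⟨c, d⟩⟩ h; simp at h ⊢; omega)
      (by rintro ⟨⟨a, b⟩, ⟨c, d⟩⟩ h; simp at h ⊢; omega)
      (by rintro ⟨⟨a, b⟩, ⟨c, d⟩⟩ h; simp at h ⊢; obtain ⟨_, rfl⟩ := h; rfl)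
      (by rintro ⟨⟨a, b⟩, ⟨c, d⟩⟩ h; simp at h ⊢; obtain ⟨_, rfl⟩ := h; rfl)
      (by rintro ⟨⟨a, b⟩, ⟨c, d⟩⟩ h; rfl)

/-- The `ℂ⟦h⟧`-linear extension `M[[h]] → N[[h]]` of a `ℂ`-linear map `M → N`. -/
def map (g : M →ₗ[ℂ] N) : HSeries M →ₗ[ℂ⟦X⟧] HSeries N :=
  ofHomCoeff fun n => if n = 0 then g else 0

end Module

end HSeries

/-! ## Formal series -/

section Series

variable (V : Type*) [AddCommGroup V] [Module ℂ V]

/-- The space `V_h((z))` for the topologically free module `V[[h]]`: two-sided formal series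
`∑ F a z^a` with coefficients in `V[[h]]` such that `F a → 0` `h`-adically as `a → -∞`. (In the
form `∑ v_r z^(-r-1)` this says that `v_r → 0` as `r → ∞`.) -/
def LaurentH : Submodule ℂ⟦X⟧ (ℤ → HSeries V) where
  carrier := {F | ∀ n : ℕ, ∃ N : ℤ, ∀ a < N, F a ∈ HSeries.hPow V n}
  add_mem' := by
    intro F G hF hG n
    obtain ⟨N, hN⟩ := hF n
    obtain ⟨N', hN'⟩ := hG n
    exact ⟨min N N', fun a ha => Submodule.add_mem _ (hN a (lt_of_lt_of_le ha (min_le_left _ _)))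
      (hN' a (lt_of_lt_of_le ha (min_le_right _ _)))⟩
  zero_mem' := fun _ => ⟨0, fun _ _ => Submodule.zero_mem _⟩
  smul_mem' := by
    intro c F hF n
    obtain ⟨N, hN⟩ := hF n
    exact ⟨N, fun a ha => Submodule.smul_mem _ _ (hN a ha)⟩

variable {V}

/-- Multiplication of a formal series `∑ F a b x^a y^b` in two variables, with coefficients in
`V[[h]]`, by the polynomial `x + ε y`. -/
def mulLin (ε : ℤ) (F : ℤ → ℤ → HSeries V) : ℤ → ℤ → HSeries V :=
  fun a b => F (a - 1) b + ε • F a (b - 1)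

end Series

/-- The substitution `f(z) ↦ f(-z)` on `ℂ((z))`. -/
def laurentNeg : LaurentSeries ℂ →ₗ[ℂ] LaurentSeries ℂ where
  toFun f := HahnSeries.ofSuppBddBelow (fun n : ℤ => ((-1 : ℂ) ^ n) * f.coeff n) (by
    refine ⟨f.order, fun n hn => ?_⟩
    contrapose! hn
    simp [HahnSeries.coeff_eq_zero_of_lt_order hn])
  map_add' f g := by
    ext n
    simp only [HahnSeries.ofSuppBddBelow, HahnSeries.coeff_add, mul_add]
  map_smul' c f := by
    ext n
    simp only [HahnSeries.ofSuppBddBelow, HahnSeries.coeff_smul, RingHom.id_apply, smul_eq_mul,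
      mul_left_comm]

/-- The substitution `f(z) ↦ f(z₁)` from `ℂ((z))` to `ℂ((z₁))((z₂))`. -/
def laurentFst : LaurentSeries ℂ →ₗ[ℂ] LaurentSeries (LaurentSeries ℂ) :=
  HahnSeries.single.linearMap 0

/-- The substitution `f(z) ↦ f(z₂)` from `ℂ((z))` to `ℂ((z₁))((z₂))`. -/
def laurentSnd : LaurentSeries ℂ →ₗ[ℂ] LaurentSeries (LaurentSeries ℂ) where
  toFun f := f.map (HahnSeries.single.linearMap 0 : ℂ →ₗ[ℂ] LaurentSeries ℂ)
  map_add' f g := by ext n : 2; simp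
  map_smul' c f := by ext n : 2; simp

/-- The substitution `f(z) ↦ f(z₁ + z₂)` from `ℂ((z))` to `ℂ((z₁))((z₂))`, expanded in nonnegative
powers of `z₂` by the Taylor formula `f(z₁ + z₂) = ∑ⱼ (f⁽ʲ⁾(z₁) / j!) z₂ʲ`. -/
def laurentAdd : LaurentSeries ℂ →ₗ[ℂ] LaurentSeries (LaurentSeries ℂ) where
  toFun f := HahnSeries.ofPowerSeries ℤ (LaurentSeries ℂ)
    (PowerSeries.mk fun j => LaurentSeries.hasseDeriv ℂ j f)
  map_add' f g := by
    rw [← map_add]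
    congr 1
    ext1 j
    simp
  map_smul' c f := by
    ext n : 2
    rw [RingHom.id_apply, HahnSeries.coeff_smul, PowerSeries.coeff_coe, PowerSeries.coeff_coe]
    split_ifs <;> simp

theorem laurent_smul_eq {R : Type*} [CommRing R] [Module ℂ R] [IsScalarTower ℂ R R] (c : ℂ)
    (f : LaurentSeries R) : c • f = HahnSeries.single 0 (c • (1 : R)) * f := by
  ext n
  rw [HahnSeries.coeff_single_zero_mul, HahnSeries.coeff_smul, smul_mul_assoc, one_mul]

instance {R : Type*} [CommRing R] [Module ℂ R] [IsScalarTower ℂ R R] :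
    IsScalarTower ℂ (LaurentSeries R) (LaurentSeries R) :=
  ⟨fun c f g => by
    rw [smul_eq_mul, smul_eq_mul, laurent_smul_eq c f, laurent_smul_eq c (f * g), mul_assoc]⟩

instance {R : Type*} [CommRing R] [Module ℂ R] [IsScalarTower ℂ R R] :
    SMulCommClass ℂ (LaurentSeries R) (LaurentSeries R) :=
  ⟨fun c f g => by
    rw [smul_eq_mul, smul_eq_mul, laurent_smul_eq c g, laurent_smul_eq c (f * g), mul_left_comm]⟩

/-! ## Operators on tensor products -/

section Operators

variable {V M A B : Type*} [AddCommGroup V] [Module ℂ V] [AddCommGroup M] [Module ℂ M]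
  [CommRing A] [Module ℂ A] [SMulCommClass ℂ A A] [IsScalarTower ℂ A A] [AddCommGroup B]
  [Module ℂ B]

/-- For `K : V ⊗ V → V ⊗ V ⊗ B`, the map `K₁₂ : V ⊗ V ⊗ V → V ⊗ V ⊗ V ⊗ B` acting on the first
two factors. -/
def leg12 (K : V ⊗[ℂ] V →ₗ[ℂ] (V ⊗[ℂ] V) ⊗[ℂ] B) :
    (V ⊗[ℂ] V) ⊗[ℂ] V →ₗ[ℂ] ((V ⊗[ℂ] V) ⊗[ℂ] V) ⊗[ℂ] B :=
  (TensorProduct.rightComm ℂ (V ⊗[ℂ] V) B V).toLinearMap ∘ₗ K.rTensor V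

/-- For `K : V ⊗ V → V ⊗ V ⊗ B`, the map `K₁₃ : V ⊗ V ⊗ V → V ⊗ V ⊗ V ⊗ B` acting on the first
and the third factor, obtained from `K₁₂` by permuting the second and the third factor. -/
def leg13 (K : V ⊗[ℂ] V →ₗ[ℂ] (V ⊗[ℂ] V) ⊗[ℂ] B) :
    (V ⊗[ℂ] V) ⊗[ℂ] V →ₗ[ℂ] ((V ⊗[ℂ] V) ⊗[ℂ] V) ⊗[ℂ] B :=
  (TensorProduct.rightComm ℂ V V V).toLinearMap.rTensor B ∘ₗ leg12 K ∘ₗ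
    (TensorProduct.rightComm ℂ V V V).toLinearMap

/-- For `K : V ⊗ V → V ⊗ V ⊗ B`, the map `K₂₃ : V ⊗ V ⊗ V → V ⊗ V ⊗ V ⊗ B` acting on the last
two factors. -/
def leg23 (K : V ⊗[ℂ] V →ₗ[ℂ] (V ⊗[ℂ] V) ⊗[ℂ] B) :
    (V ⊗[ℂ] V) ⊗[ℂ] V →ₗ[ℂ] ((V ⊗[ℂ] V) ⊗[ℂ] V) ⊗[ℂ] B :=
  (TensorProduct.assoc ℂ V V V).symm.toLinearMap.rTensor B ∘ₗ
    (TensorProduct.assoc ℂ V (V ⊗[ℂ] V) B).symm.toLinearMap ∘ₗ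
    K.lTensor V ∘ₗ (TensorProduct.assoc ℂ V V V).toLinearMap

/-- For `K : V ⊗ V → V ⊗ V ⊗ B`, the map `K₂₁ = P K P`, where `P` permutes the two factors `V`. -/
def leg21 (K : V ⊗[ℂ] V →ₗ[ℂ] (V ⊗[ℂ] V) ⊗[ℂ] B) :
    V ⊗[ℂ] V →ₗ[ℂ] (V ⊗[ℂ] V) ⊗[ℂ] B :=
  (TensorProduct.comm ℂ V V).toLinearMap.rTensor B ∘ₗ K ∘ₗ (TensorProduct.comm ℂ V V).toLinearMap

/-- For `K : M → M ⊗ B` and a substitution `φ : B → A`, the `A`-linear operator on `M ⊗ A`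
extending `(1 ⊗ φ) ∘ K : M → M ⊗ A`. -/
def scalarExt (φ : B →ₗ[ℂ] A) (K : M →ₗ[ℂ] M ⊗[ℂ] B) : M ⊗[ℂ] A →ₗ[ℂ] M ⊗[ℂ] A :=
  (LinearMap.mul' ℂ A ∘ₗ φ.rTensor A).lTensor M ∘ₗ
    (TensorProduct.assoc ℂ M B A).toLinearMap ∘ₗ K.rTensor A

/-- For a `ℂ⟦h⟧`-linear map `S : M[[h]] → (M ⊗ B)[[h]]` and a substitution `φ : B → A`, the
operator on `(M ⊗ A)[[h]]` which is linear over `A` and `ℂ⟦h⟧` and extends `(1 ⊗ φ) ∘ S`;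
before that, each coefficient of `S` is placed on the tensor factors prescribed by `leg`. -/
def placed {M' : Type*} [AddCommGroup M'] [Module ℂ M'] (φ : B →ₗ[ℂ] A)
    (leg : (M →ₗ[ℂ] M ⊗[ℂ] B) → (M' →ₗ[ℂ] M' ⊗[ℂ] B))
    (S : HSeries M →ₗ[ℂ⟦X⟧] HSeries (M ⊗[ℂ] B)) :
    HSeries (M' ⊗[ℂ] A) →ₗ[ℂ⟦X⟧] HSeries (M' ⊗[ℂ] A) :=
  HSeries.ofHomCoeff fun n => scalarExt φ (leg (HSeries.homCoeff S n))

/-- For `D : V[[h]] → V[[h]]`, the map `D ⊗ 1` on the completed tensor product `(V ⊗ M)[[h]]`. -/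
def tensorOne (M : Type*) [AddCommGroup M] [Module ℂ M] (D : HSeries V →ₗ[ℂ⟦X⟧] HSeries V) :
    HSeries (V ⊗[ℂ] M) →ₗ[ℂ⟦X⟧] HSeries (V ⊗[ℂ] M) :=
  HSeries.ofHomCoeff fun n => (HSeries.homCoeff D n).rTensor M

/-- The coefficient `S_m` of `z^m` of a map `S(z) : V ⊗ V → V ⊗ V ⊗ ℂ((z))`. -/
def coeffS (S : HSeries (V ⊗[ℂ] V) →ₗ[ℂ⟦X⟧] HSeries ((V ⊗[ℂ] V) ⊗[ℂ] LaurentSeries ℂ)) (m : ℤ) :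
    HSeries (V ⊗[ℂ] V) →ₗ[ℂ⟦X⟧] HSeries (V ⊗[ℂ] V) :=
  HSeries.map ((TensorProduct.rid ℂ (V ⊗[ℂ] V)).toLinearMap ∘ₗ
    (HahnSeries.coeff.linearMap (R := ℂ) (V := ℂ) m).lTensor (V ⊗[ℂ] V)) ∘ₗ S

/-- The operator `d/dz` on `V ⊗ V ⊗ ℂ((z))`. -/
def ddz (V : Type*) [AddCommGroup V] [Module ℂ V] :
    HSeries ((V ⊗[ℂ] V) ⊗[ℂ] LaurentSeries ℂ) →ₗ[ℂ⟦X⟧]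
      HSeries ((V ⊗[ℂ] V) ⊗[ℂ] LaurentSeries ℂ) :=
  HSeries.map ((LaurentSeries.derivative ℂ (V := ℂ)).lTensor (V ⊗[ℂ] V))

end Operators

/-! ## Vertex operators -/

section VertexOperators

variable {V : Type*} [AddCommGroup V] [Module ℂ V]

/-- The coefficient of `z^a` of the vertex operator map `Y(z) : V ⊗ V → V_h((z))`. -/
def coeffY (Y : HSeries (V ⊗[ℂ] V) →ₗ[ℂ⟦X⟧] LaurentH V) (a : ℤ) :
    HSeries (V ⊗[ℂ] V) →ₗ[ℂ⟦X⟧] HSeries V :=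
  LinearMap.proj a ∘ₗ (LaurentH V).subtype ∘ₗ Y

/-- The vector `v_r w`, where `Y(v,z) w = ∑ (v_r w) z^(-r-1)`. -/
def modeY (Y : HSeries (V ⊗[ℂ] V) →ₗ[ℂ⟦X⟧] LaurentH V) (v : HSeries V) (r : ℤ) (w : HSeries V) :
    HSeries V :=
  coeffY Y (-r - 1) (HSeries.tmul v w)

/-- The map `1 ⊗ Y_a : V ⊗ V ⊗ V → V ⊗ V`, where `Y_a` is the coefficient of `z^a` of `Y(z)`. -/
def oneTensorY (Y : HSeries (V ⊗[ℂ] V) →ₗ[ℂ⟦X⟧] LaurentH V) (a : ℤ) :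
    HSeries ((V ⊗[ℂ] V) ⊗[ℂ] V) →ₗ[ℂ⟦X⟧] HSeries (V ⊗[ℂ] V) :=
  HSeries.ofHomCoeff fun n =>
    (HSeries.homCoeff (coeffY Y a) n).lTensor V ∘ₗ (TensorProduct.assoc ℂ V V V).toLinearMap

/-- The coefficients (of `x^a y^b`) of the series `Y(x)(1 ⊗ Y(y)) t` for `t ∈ V ⊗ V ⊗ V`. -/
def YY (Y : HSeries (V ⊗[ℂ] V) →ₗ[ℂ⟦X⟧] LaurentH V) (t : HSeries ((V ⊗[ℂ] V) ⊗[ℂ] V)) :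
    ℤ → ℤ → HSeries V :=
  fun a b => coeffY Y a (oneTensorY Y b t)

/-- The coefficients (of `z₀^a z₂^b`) of `Y(v, z₀ + z₂) Y(w, z₂) u`, where the powers
`(z₀ + z₂)^m = ∑ⱼ C(m, j) z₀^(m-j) z₂^j` are expanded in nonnegative powers of `z₂`. The sum over
`j` converges `h`-adically because `Y(w, z₂) u ∈ V_h((z₂))`. -/
def shiftedProduct (Y : HSeries (V ⊗[ℂ] V) →ₗ[ℂ⟦X⟧] LaurentH V) (v w u : HSeries V) :
    ℤ → ℤ → HSeries V :=
  fun a b => HSeries.hsum fun j : ℕ =>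
    Ring.choose (a + j) j •
      coeffY Y (a + j) (HSeries.tmul v (coeffY Y (b - j) (HSeries.tmul w u)))

/-- The coefficients (of `z₀^a z₂^b`) of `Y(Y(v, z₀) w, z₂) u`. -/
def iteratedProduct (Y : HSeries (V ⊗[ℂ] V) →ₗ[ℂ⟦X⟧] LaurentH V) (v w u : HSeries V) :
    ℤ → ℤ → HSeries V :=
  fun a b => coeffY Y b (HSeries.tmul (coeffY Y a (HSeries.tmul v w)) u)

/-- The coefficients (of `z₁^a z₂^b`) of `Y(z₁)(1 ⊗ Y(z₂))(S(z₁ - z₂)(v ⊗ w) ⊗ u)`. Here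
`S(z₁ - z₂) = ∑ₘ Sₘ (z₁ - z₂)^m`, and the powers
`(z₁ - z₂)^m = ∑_d (-1)^d C(m, d) z₁^(m-d) z₂^d` are expanded in nonnegative powers of `z₂`. The
sum over `(m, d)` converges `h`-adically because of the truncation properties of `Y` and `S`. -/
def braidedProduct (Y : HSeries (V ⊗[ℂ] V) →ₗ[ℂ⟦X⟧] LaurentH V)
    (S : HSeries (V ⊗[ℂ] V) →ₗ[ℂ⟦X⟧] HSeries ((V ⊗[ℂ] V) ⊗[ℂ] LaurentSeries ℂ))
    (v w u : HSeries V) : ℤ → ℤ → HSeries V :=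
  fun a b => HSeries.hsum fun p : ℤ × ℕ =>
    ((-1) ^ p.2 * Ring.choose p.1 p.2) •
      YY Y (HSeries.tmul (coeffS S p.1 (HSeries.tmul v w)) u) (a - (p.1 - p.2)) (b - p.2)

/-- The coefficients (of `z₁^a z₂^b`) of `Y(w, z₂) Y(v, z₁) u = Y(z₂)(1 ⊗ Y(z₁))(w ⊗ v ⊗ u)`. -/
def oppositeProduct (Y : HSeries (V ⊗[ℂ] V) →ₗ[ℂ⟦X⟧] LaurentH V) (v w u : HSeries V) :
    ℤ → ℤ → HSeries V :=
  fun a b => coeffY Y b (HSeries.tmul w (coeffY Y a (HSeries.tmul v u)))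

end VertexOperators

/-! ## Quantum vertex algebras -/

/-- A quantum vertex algebra structure on the topologically free `ℂ⟦h⟧`-module `V[[h]]`, where `V`
is a complex vector space. All tensor products of `ℂ⟦h⟧`-modules are `h`-adically completed. -/
structure QuantumVertexAlgebra (V : Type*) [AddCommGroup V] [Module ℂ V] where
  /-- The vertex operators `Y(z) : V ⊗ V → V_h((z))`. -/
  Y : HSeries (V ⊗[ℂ] V) →ₗ[ℂ⟦X⟧] LaurentH V
  /-- Weak associativity, modulo every power of `h`. -/
  weak_assoc : ∀ (u v w : HSeries V) (n : ℕ), ∃ l : ℕ, ∀ a b : ℤ,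
    (mulLin 1)^[l] (shiftedProduct Y v w u) a b - (mulLin 1)^[l] (iteratedProduct Y v w u) a b
      ∈ HSeries.hPow V n
  /-- The vacuum vector, denoted `1` below. -/
  vac : HSeries V
  /-- The identity `Y(1, z) v = v`. -/
  vac_left : ∀ (v : HSeries V) (a : ℤ),
    coeffY Y a (HSeries.tmul vac v) = if a = 0 then v else 0
  /-- The series `Y(v, z) 1` has no negative powers of `z`. -/
  vac_right_taylor : ∀ (v : HSeries V) (a : ℤ), a < 0 → coeffY Y a (HSeries.tmul v vac) = 0
  /-- The constant term of `Y(v, z) 1` is `v`. -/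
  vac_right_zero : ∀ v : HSeries V, coeffY Y 0 (HSeries.tmul v vac) = v
  /-- The translation operator. -/
  D : HSeries V →ₗ[ℂ⟦X⟧] HSeries V
  D_vac : D vac = 0
  /-- The identity `d/dz Y(v, z) = [D, Y(v, z)]`, coefficient by coefficient. -/
  D_comm : ∀ (v w : HSeries V) (a : ℤ),
    (a + 1) • coeffY Y (a + 1) (HSeries.tmul v w)
      = D (coeffY Y a (HSeries.tmul v w)) - coeffY Y a (HSeries.tmul v (D w))
  /-- The braiding `S(z) : V ⊗ V → V ⊗ V ⊗ ℂ((z))`. -/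
  S : HSeries (V ⊗[ℂ] V) →ₗ[ℂ⟦X⟧] HSeries ((V ⊗[ℂ] V) ⊗[ℂ] LaurentSeries ℂ)
  /-- `S(z)(v ⊗ w) - v ⊗ w ⊗ 1` is divisible by `h`. -/
  S_mod_h : ∀ v w : HSeries V,
    S (HSeries.tmul v w) - HSeries.tmul (HSeries.tmul v w) (HSeries.const (1 : LaurentSeries ℂ))
      ∈ HSeries.hPow ((V ⊗[ℂ] V) ⊗[ℂ] LaurentSeries ℂ) 1
  /-- The shift condition `[D ⊗ 1, S(z)] = -d/dz S(z)`. -/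
  S_shift :
    HSeries.ofHomCoeff (fun n => ((HSeries.homCoeff D n).rTensor V).rTensor (LaurentSeries ℂ)) ∘ₗ S
      - S ∘ₗ tensorOne V D = -(ddz V ∘ₗ S)
  /-- The Yang–Baxter equation
  `S₁₂(z₁) S₁₃(z₁ + z₂) S₂₃(z₂) = S₂₃(z₂) S₁₃(z₁ + z₂) S₁₂(z₁)`. -/
  yang_baxter :
    placed (A := LaurentSeries (LaurentSeries ℂ)) laurentFst leg12 S ∘ₗ placed (A := LaurentSeries (LaurentSeries ℂ)) laurentAdd leg13 S ∘ₗ placed (A := LaurentSeries (LaurentSeries ℂ)) laurentSnd leg23 S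
      = placed (A := LaurentSeries (LaurentSeries ℂ)) laurentSnd leg23 S ∘ₗ placed (A := LaurentSeries (LaurentSeries ℂ)) laurentAdd leg13 S ∘ₗ placed (A := LaurentSeries (LaurentSeries ℂ)) laurentFst leg12 S
  /-- Unitarity: `S₂₁(z)` is the two-sided inverse of `S(-z)`. -/
  unitarity_left :
    placed (A := LaurentSeries ℂ) LinearMap.id leg21 S ∘ₗ placed (A := LaurentSeries ℂ) laurentNeg id S = LinearMap.id
  unitarity_right :
    placed (A := LaurentSeries ℂ) laurentNeg id S ∘ₗ placed (A := LaurentSeries ℂ) LinearMap.id leg21 S = LinearMap.id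
  /-- `S`-locality, modulo every power of `h`. -/
  S_locality : ∀ (v w : HSeries V) (n : ℕ), ∃ l : ℕ, ∀ (u : HSeries V) (a b : ℤ),
    (mulLin (-1))^[l] (braidedProduct Y S v w u) a b
      - (mulLin (-1))^[l] (oppositeProduct Y v w u) a b ∈ HSeries.hPow V n

/-- The center of a quantum vertex algebra: the `ℂ⟦h⟧`-submodule of all `v` such that `w_r v = 0`
for all `w` and all `r ≥ 0`. -/
def QuantumVertexAlgebra.center {V : Type*} [AddCommGroup V] [Module ℂ V]
    (Q : QuantumVertexAlgebra V) : Submodule ℂ⟦X⟧ (HSeries V) where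
  carrier := {v | ∀ (w : HSeries V) (r : ℤ), 0 ≤ r → modeY Q.Y w r v = 0}
  add_mem' := by
    intro v v' hv hv' w r hr
    have h1 := hv w r hr
    have h2 := hv' w r hr
    simp only [modeY] at h1 h2 ⊢
    rw [HSeries.tmul_add, map_add, h1, h2, add_zero]
  zero_mem' := by
    intro w r hr
    have : HSeries.tmul w (0 : HSeries V) = 0 := by ext n; simp [HSeries.tmul]
    simp only [modeY]
    rw [this, map_zero]
  smul_mem' := by
    intro f v hv w r hr
    have h1 := hv w r hr
    simp only [modeY] at h1 ⊢
    rw [HSeries.tmul_smul, map_smul, h1, smul_zero]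

end

/-! When `u` is central, `Y(w,z₂)u` has no negative powers of `z₂`. On series of this kind,
multiplication by a power of `z₁ ± z₂` can be cancelled: compare coefficients, starting from the
lowest power of `z₂`. Doing this modulo each `hⁿ` and using `h`-adic separatedness turns weak
identities into exact ones (`eq_of_iterate_mulLin`).

For the forward direction, the weak identity is `S`-locality. The braided side has no negative
powers of `z₂` by `braidedProduct_eq_zero`; the opposite side has none because the center is closed
under products (`coeffY_mem_center`). That closure comes from weak associativity, itself made exact
by the same cancellation.

The converse needs only the vacuum: the constant term in `z₁` of the opposite side at `u = 1` is
`Y(w,z₂)v`, while the braided side has no negative powers of `z₂`. -/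

namespace HSeries

/-! ### Sums, coefficients and separatedness of `h`-adic series -/

theorem hsum_eq_zero {M ι : Type*} [AddCommGroup M] {x : ι → HSeries M} (hx : ∀ i, x i = 0) : hsum x = 0 := by
  ext k
  simp [hsum, hx]

theorem hsum_eq_single {M ι : Type*} [AddCommGroup M] {x : ι → HSeries M} (i : ι) (hx : ∀ j, j ≠ i → x j = 0) :
    hsum x = x i := by
  ext k
  exact finsum_eq_single _ i fun j hj => by simp [hx j hj]

variable {M N : Type*} [AddCommGroup M] [Module ℂ M] [AddCommGroup N] [Module ℂ N]

theorem coeff_X_smul_zero (x : HSeries M) : ((PowerSeries.X : ℂ⟦X⟧) • x).coeff 0 = 0 := by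
  simp [coeff_smul]

theorem coeff_X_smul_succ (x : HSeries M) (n : ℕ) :
    ((PowerSeries.X : ℂ⟦X⟧) • x).coeff (n + 1) = x.coeff n := by
  rw [coeff_smul, Finset.sum_eq_single (1, n)]
  · simp
  · rintro ⟨i, j⟩ hp hne
    have hi : i ≠ 1 := by
      rintro rfl
      apply hne
      have : 1 + j = n + 1 := by simpa using hp
      ext <;> simp
      omega
    simp [PowerSeries.coeff_X, hi]
  · intro h
    exact absurd (by simp [add_comm]) h

theorem eq_const_add_X_smul (x : HSeries M) :
    x = const (x.coeff 0) + (PowerSeries.X : ℂ⟦X⟧) • (⟨fun n => x.coeff (n + 1)⟩ : HSeries M) := by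
  ext n
  cases n with
  | zero => rw [coeff_add, coeff_X_smul_zero]; simp [const]
  | succ n => rw [coeff_add, coeff_X_smul_succ]; simp [const]

/-- A `ℂ⟦h⟧`-linear map is determined by its coefficients. -/
theorem coeff_apply (G : HSeries M →ₗ[ℂ⟦X⟧] HSeries N) (n : ℕ) (x : HSeries M) :
    (G x).coeff n =
      ∑ p ∈ Finset.HasAntidiagonal.antidiagonal n, homCoeff G p.1 (x.coeff p.2) := by
  -- Splitting off the constant term leaves a multiple of `h`, which `G` carries to a multiple of
  -- `h`. Hence only finitely many coefficients of `x` matter, and no continuity argument is needed.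
  induction n generalizing x with
  | zero =>
    conv_lhs => rw [eq_const_add_X_smul x, map_add, map_smul, coeff_add, coeff_X_smul_zero]
    simp [homCoeff]
  | succ n ih =>
    conv_lhs => rw [eq_const_add_X_smul x, map_add, map_smul, coeff_add, coeff_X_smul_succ, ih]
    rw [Finset.Nat.sum_antidiagonal_succ']
    rfl

theorem coeff_eq_zero_of_mem_hPow {n k : ℕ} (hk : k < n) {x : HSeries M} (hx : x ∈ hPow M n) :
    x.coeff k = 0 := by
  obtain ⟨y, rfl⟩ := hx
  rw [coeff_smul]
  refine Finset.sum_eq_zero fun p hp => ?_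
  have hp' : p.1 + p.2 = k := by simpa using hp
  rw [PowerSeries.coeff_X_pow, if_neg (by omega), zero_smul]

theorem eq_zero_of_forall_mem_hPow {x : HSeries M} (hx : ∀ n, x ∈ hPow M n) : x = 0 := by
  ext k
  exact coeff_eq_zero_of_mem_hPow k.lt_succ_self (hx (k + 1))

theorem tmul_zero (x : HSeries M) : tmul x (0 : HSeries N) = 0 := by
  ext n
  simp [tmul]

theorem zero_tmul (y : HSeries N) : tmul (0 : HSeries M) y = 0 := by
  ext n
  simp [tmul]

theorem coeff_const_tmul (m : M) (y : HSeries N) (n : ℕ) :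
    (tmul (const m) y).coeff n = m ⊗ₜ[ℂ] y.coeff n := by
  simp only [tmul]
  rw [Finset.sum_eq_single (0, n)]
  · simp [const]
  · rintro ⟨i, j⟩ hp hne
    have hi : i ≠ 0 := by
      rintro rfl
      apply hne
      simpa using hp
    simp [const, hi]
  · simp

end HSeries

/-! ### Cancelling powers of `x + ε y` -/

section Cancellation

theorem iterate_mulLin_sub {V : Type*} [AddCommGroup V] (ε : ℤ) (l : ℕ) (F G : ℤ → ℤ → HSeries V) :
    (mulLin ε)^[l] (F - G) = (mulLin ε)^[l] F - (mulLin ε)^[l] G := by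
  induction l generalizing F G with
  | zero => rfl
  | succ l ih =>
    have h : mulLin ε (F - G) = mulLin ε F - mulLin ε G := by
      funext a b
      simp only [mulLin, Pi.sub_apply, smul_sub]
      abel
    rw [Function.iterate_succ_apply, Function.iterate_succ_apply, Function.iterate_succ_apply,
      h, ih]

variable {V : Type*} [AddCommGroup V] [Module ℂ V] {P : Submodule ℂ⟦X⟧ (HSeries V)}

/-- Multiplication by `x + ε y` is injective on series with no negative powers of `y`. -/
theorem mem_of_mulLin_mem (ε : ℤ) {F : ℤ → ℤ → HSeries V} (hF : ∀ a, ∀ b < 0, F a b ∈ P)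
    (h : ∀ a b, mulLin ε F a b ∈ P) (a b : ℤ) : F a b ∈ P := by
  -- The shift by one puts the base case at exponent `-1`, where `hF` applies.
  have key : ∀ (n : ℕ) (a : ℤ), F a ((n : ℤ) - 1) ∈ P := by
    intro n
    induction n with
    | zero => exact fun a => hF a _ (by simp)
    | succ n ih =>
      intro a
      -- The coefficient of `x^(a+1) y^n` in the product is `F a n + ε F (a+1) (n-1)`; its second
      -- term is known.
      have h1 := P.sub_mem (h (a + 1) n) (zsmul_mem (ih (a + 1)) ε)
      simpa [mulLin] using h1
  rcases lt_or_ge b 0 with hb | hb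
  · exact hF a b hb
  · have := key (b + 1).toNat a
    rwa [Int.toNat_of_nonneg (by omega), add_sub_cancel_right] at this

theorem mem_of_iterate_mulLin_mem (ε : ℤ) (l : ℕ) {F : ℤ → ℤ → HSeries V}
    (hF : ∀ a, ∀ b < 0, F a b ∈ P) (h : ∀ a b, (mulLin ε)^[l] F a b ∈ P) (a b : ℤ) :
    F a b ∈ P := by
  induction l generalizing F a b with
  | zero => exact h a b
  | succ l ih =>
    refine mem_of_mulLin_mem ε hF (fun a b => ih (fun a b hb => ?_) h a b) a b
    exact P.add_mem (hF _ _ hb) (zsmul_mem (hF _ _ (by omega)) ε)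

/-- Two series without negative powers of `y` agree if, modulo every power of `h`, they agree after
multiplication by some power of `x + ε y`. -/
theorem eq_of_iterate_mulLin (ε : ℤ) {F G : ℤ → ℤ → HSeries V} (hF : ∀ a, ∀ b < 0, F a b = 0)
    (hG : ∀ a, ∀ b < 0, G a b = 0)
    (h : ∀ n, ∃ l : ℕ, ∀ a b,
      (mulLin ε)^[l] F a b - (mulLin ε)^[l] G a b ∈ HSeries.hPow V n) : F = G := by
  funext a b
  rw [← sub_eq_zero]
  -- The exponent `l` may grow with `n`, so the cancellation is carried out separately modulo each
  -- `hⁿ`.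
  refine HSeries.eq_zero_of_forall_mem_hPow fun n => ?_
  obtain ⟨l, hl⟩ := h n
  refine mem_of_iterate_mulLin_mem (F := F - G) ε l (fun a b hb => ?_) (fun a b => ?_) a b
  · simp [hF a b hb, hG a b hb]
  · rw [iterate_mulLin_sub]
    exact hl a b

end Cancellation

/-! ### Products with central vectors -/

namespace QuantumVertexAlgebra

variable {V : Type*} [AddCommGroup V] [Module ℂ V] (Q : QuantumVertexAlgebra V)

theorem mem_center_iff {v : HSeries V} :
    v ∈ Q.center ↔ ∀ (w : HSeries V), ∀ a < 0, coeffY Q.Y a (HSeries.tmul w v) = 0 := by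
  constructor
  · intro h w a ha
    have := h w (-a - 1) (by omega)
    rwa [modeY, show -(-a - 1) - 1 = a by ring] at this
  · exact fun h w r hr => h w (-r - 1) (by omega)

theorem vac_mem_center : Q.vac ∈ Q.center :=
  Q.mem_center_iff.2 Q.vac_right_taylor

/-- On a pure tensor `v ⊗ w` this is the centrality of `u` tested against `w`. A general `x`, such
as a value of `S`, is not pure, so the argument runs through the `h`-coefficients of `x`, each a
finite sum of pure tensors. -/
theorem oneTensorY_tmul_eq_zero {u : HSeries V} (hu : u ∈ Q.center) {b : ℤ} (hb : b < 0)
    (x : HSeries (V ⊗[ℂ] V)) : oneTensorY Q.Y b (HSeries.tmul x u) = 0 := by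
  set g : ℕ → V ⊗[ℂ] V →ₗ[ℂ] V := HSeries.homCoeff (coeffY Q.Y b) with hg
  have hgu : ∀ (w : V) (n : ℕ),
      ∑ p ∈ Finset.HasAntidiagonal.antidiagonal n, g p.1 (w ⊗ₜ u.coeff p.2) = 0 := by
    intro w n
    have h := congrArg (fun y => HSeries.coeff y n) (Q.mem_center_iff.1 hu (HSeries.const w) b hb)
    simpa only [HSeries.coeff_apply, HSeries.coeff_const_tmul, HSeries.coeff_zero] using h
  have hgt : ∀ (t : V ⊗[ℂ] V) (n : ℕ), ∑ p ∈ Finset.HasAntidiagonal.antidiagonal n,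
      ((g p.1).lTensor V) (TensorProduct.assoc ℂ V V V (t ⊗ₜ u.coeff p.2)) = 0 := by
    intro t n
    induction t with
    | zero => simp
    | tmul v w =>
      simp only [TensorProduct.assoc_tmul, LinearMap.lTensor_tmul]
      rw [← TensorProduct.tmul_sum, hgu, TensorProduct.tmul_zero]
    | add s t hs ht =>
      simp only [TensorProduct.add_tmul, map_add, Finset.sum_add_distrib, hs, ht, add_zero]
  ext n
  change ∑ p ∈ Finset.HasAntidiagonal.antidiagonal n, ((g p.1).lTensor V)
    (TensorProduct.assoc ℂ V V V (∑ q ∈ Finset.HasAntidiagonal.antidiagonal p.2, _)) = 0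
  simp only [map_sum]
  rw [Finset.sum_sigma']
  -- Regroup the triple Cauchy product so that the coefficient of `x` is outermost; each inner sum
  -- is then an instance of `hgt`.
  trans ∑ p ∈ Finset.HasAntidiagonal.antidiagonal n,
    ∑ q ∈ Finset.HasAntidiagonal.antidiagonal p.2, ((g q.1).lTensor V)
      (TensorProduct.assoc ℂ V V V (x.coeff p.1 ⊗ₜ u.coeff q.2))
  · rw [Finset.sum_sigma']
    exact Finset.sum_nbij'
      (fun p => ⟨(p.2.1, p.1.1 + p.2.2), (p.1.1, p.2.2)⟩)
      (fun p => ⟨(p.2.1, p.1.1 + p.2.2), (p.1.1, p.2.2)⟩)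
      (by rintro ⟨⟨a, b⟩, ⟨c, d⟩⟩ h; simp at h ⊢; omega)
      (by rintro ⟨⟨a, b⟩, ⟨c, d⟩⟩ h; simp at h ⊢; omega)
      (by rintro ⟨⟨a, b⟩, ⟨c, d⟩⟩ h; simp at h ⊢; obtain ⟨_, rfl⟩ := h; rfl)
      (by rintro ⟨⟨a, b⟩, ⟨c, d⟩⟩ h; simp at h ⊢; obtain ⟨_, rfl⟩ := h; rfl)
      (by rintro ⟨⟨a, b⟩, ⟨c, d⟩⟩ h; rfl)
  · exact Finset.sum_eq_zero fun p _ => hgt _ _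

/-- The expansion of `(z₁ - z₂)^m` contributes only nonnegative powers of `z₂`, so each term
involves a coefficient of `1 ⊗ Y(z₂)` at a negative exponent. -/
theorem braidedProduct_eq_zero {u : HSeries V} (hu : u ∈ Q.center) (v w : HSeries V) (a : ℤ)
    {b : ℤ} (hb : b < 0) : braidedProduct Q.Y Q.S v w u a b = 0 := by
  refine HSeries.hsum_eq_zero fun p => ?_
  rw [YY, Q.oneTensorY_tmul_eq_zero hu (by omega), map_zero, smul_zero]

/-- Centrality of `u` removes the negative powers of `z₂` from both sides, so the factor `(z₀ +
z₂)^l` in weak associativity cancels. -/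
theorem shiftedProduct_eq_iteratedProduct {u : HSeries V} (hu : u ∈ Q.center) (v w : HSeries V) :
    shiftedProduct Q.Y v w u = iteratedProduct Q.Y v w u := by
  refine eq_of_iterate_mulLin 1 (fun a b hb => ?_) (fun a b hb => ?_) (Q.weak_assoc u v w)
  · refine HSeries.hsum_eq_zero fun j => ?_
    rw [Q.mem_center_iff.1 hu w _ (by omega), HSeries.tmul_zero, map_zero, smul_zero]
  · exact Q.mem_center_iff.1 hu _ b hb

/-- The center is closed under the products `v_r u`. -/
theorem coeffY_mem_center {v u : HSeries V} (hv : v ∈ Q.center) (hu : u ∈ Q.center) (b : ℤ) :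
    coeffY Q.Y b (HSeries.tmul v u) ∈ Q.center := by
  rw [mem_center_iff]
  intro w a ha
  have neg : ∀ (a : ℤ), ∀ b < 0,
      coeffY Q.Y a (HSeries.tmul w (coeffY Q.Y b (HSeries.tmul v u))) = 0 := fun a b hb => by
    rw [Q.mem_center_iff.1 hu v b hb, HSeries.tmul_zero, map_zero]
  rcases lt_or_ge b 0 with hb | hb
  · exact neg a b hb
  lift b to ℕ using hb
  -- Since `v` is central, the iterated product has no negative powers of `z₀`. Its coefficient at
  -- `z₀^a z₂^b` gives a vanishing sum whose `j = 0` term is the goal; the terms with `j > 0`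
  -- involve the smaller exponent `b - j`.
  induction b using Nat.strong_induction_on generalizing a with
  | _ b ih =>
    have h := congrFun (congrFun (Q.shiftedProduct_eq_iteratedProduct hu w v) a) b
    rw [iteratedProduct, Q.mem_center_iff.1 hv w a ha, HSeries.zero_tmul, map_zero, shiftedProduct,
      HSeries.hsum_eq_single 0] at h
    · simpa using h
    intro j hj
    rcases lt_or_ge (a + j) 0 with haj | haj
    · rcases le_or_gt j b with hjb | hjb
      · have := ih (b - j) (by omega) (a + j) haj
        rw [Nat.cast_sub hjb] at this
        rw [this, smul_zero]
      · rw [neg _ _ (by omega), smul_zero]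
    -- As `a < 0`, here `0 ≤ a + j < j`, and the binomial coefficient vanishes.
    · have : Ring.choose (a + j) j = 0 := by
        obtain ⟨m, hm⟩ := Int.eq_ofNat_of_zero_le haj
        rw [hm, Ring.choose_natCast, Nat.choose_eq_zero_of_lt (by omega), Nat.cast_zero]
      rw [this, zero_smul]

end QuantumVertexAlgebra

theorem proposition3p2 {V : Type*} [AddCommGroup V] [Module ℂ V] (Q : QuantumVertexAlgebra V)
    (v : HSeries V) :
    v ∈ Q.center ↔
      ∀ (w : HSeries V), ∀ u ∈ Q.center,
        braidedProduct Q.Y Q.S v w u = oppositeProduct Q.Y v w u := by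
  constructor
  · intro hv w u hu
    refine eq_of_iterate_mulLin (-1) (fun a b hb => Q.braidedProduct_eq_zero hu v w a hb)
      (fun a b hb => Q.mem_center_iff.1 (Q.coeffY_mem_center hv hu a) w b hb) fun n => ?_
    obtain ⟨l, hl⟩ := Q.S_locality v w n
    exact ⟨l, hl u⟩
  · intro h
    rw [Q.mem_center_iff]
    intro w b hb
    -- The exponent `0` of `z₁` extracts `v` from `Y(v,z₁)1`.
    have h0 := congrFun (congrFun (h w Q.vac Q.vac_mem_center) 0) b
    rw [Q.braidedProduct_eq_zero Q.vac_mem_center v w 0 hb, oppositeProduct,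
      Q.vac_right_zero] at h0
    exact h0.symm
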